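/- Let $\Gamma$ be a discrete group. If $\Gamma$ acts by homeomorphisms on a compact Hausdorff space $Y$, let it act on $C(Y)$ by $(\gamma\cdot f)(y)=f(\gamma^{-1}y)$, let $C_c(\Gamma,C(Y))$ be the space of finitely supported functions $\Gamma\to C(Y)$, with the convolution product $(T\ast S)(\gamma)=\sum_{\gamma_1\gamma_2=\gamma}T(\gamma_1)\,(\gamma_1\cdot S(\gamma_2))$ and the norm $\|T\|=\big\|\sum_{\gamma\in\Gamma}T(\gamma)^*T(\gamma)\big\|_{C(Y)}^{1/2}$, and identify $\gamma_1\in\Gamma$ with the function that is $1$ at $\gamma_1$ and $0$ elsewhere, so that $(\gamma_1\ast S)(\gamma)=\gamma_1\cdot S(\gamma_1^{-1}\gamma)$. The group $\Gamma$ is called boundary amenable (or exact) if there exist a nonempty compact Hausdorff space $Y$ on which $\Gamma$ acts by homeomorphisms and a sequence $(S_i)_{i\in\mathbb N}\subset C_c(\Gamma,C(Y))$ such that 1. $S_i(\gamma)\ge 0$ for all $i\in\mathbb N$ and $\gamma\in\Gamma$; 2. $\sum_{\gamma\in\Gamma}S_i(\gamma)^2=1$ for all $i\in\mathbb N$; 3.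 $\lim_{i\to\infty}\|S_i-\gamma_1\ast S_i\|=0$ for every $\gamma_1\in\Gamma$. **Theorem.** Let $\Gamma$ be a countable group that acts by graph automorphisms on a locally finite tree $\mathcal T$, transitively on the vertices, and suppose that the stabilizer of every vertex of $\mathcal T$ is boundary amenable. Then $\Gamma$ is boundary amenable. -/

import Mathlib

open scoped ComplexOrder

namespace BdryAmen

universe u w

noncomputable section

variable {Γ : Type u} [Group Γ] {Y : Type w} [TopologicalSpace Y] [MulAction Γ Y]
  [ContinuousConstSMul Γ Y]

/-- The action of `Γ` on the algebra `C(Y)` of complex-valued continuous functions that is induced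
by an action of `Γ` on `Y` by homeomorphisms: `(γ · f) y = f (γ⁻¹ • y)`. -/
def act (γ : Γ) (f : C(Y, ℂ)) : C(Y, ℂ) :=
  f.comp ⟨fun y => γ⁻¹ • y, continuous_const_smul γ⁻¹⟩

@[simp]
theorem act_apply (γ : Γ) (f : C(Y, ℂ)) (y : Y) : act γ f y = f (γ⁻¹ • y) := rfl

/-- The convolution product of the space `C_c(Γ, C(Y))` of finitely supported functions:
`(T ∗ S)(γ) = ∑_{γ₁ γ₂ = γ} T(γ₁) (γ₁ · S(γ₂))`. -/
def conv (T S : Γ →₀ C(Y, ℂ)) : Γ →₀ C(Y, ℂ) :=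
  T.sum fun γ₁ a => S.sum fun γ₂ b => Finsupp.single (γ₁ * γ₂) (a * act γ₁ b)

/-- The element `γ₁ ∗ S`, where `γ₁` is identified with the unit mass at `γ₁`. -/
def deltaConv (γ₁ : Γ) (S : Γ →₀ C(Y, ℂ)) : Γ →₀ C(Y, ℂ) :=
  conv (Finsupp.single γ₁ 1) S

theorem deltaConv_apply (γ₁ : Γ) (S : Γ →₀ C(Y, ℂ)) (γ : Γ) :
    deltaConv γ₁ S γ = act γ₁ (S (γ₁⁻¹ * γ)) := by
  classical
  have h0 : act γ₁ (0 : C(Y, ℂ)) = 0 := rfl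
  unfold deltaConv conv
  rw [Finsupp.sum_single_index (by simp)]
  simp only [one_mul, Finsupp.sum, Finsupp.finsetSum_apply, Finsupp.single_apply]
  have h1 : ∀ a, γ₁ * a = γ ↔ a = γ₁⁻¹ * γ := fun a => eq_inv_mul_iff_mul_eq.symm
  simp only [h1, Finset.sum_ite_eq', Finsupp.mem_support_iff]
  split_ifs with h
  · rfl
  · rw [not_not.mp h, h0]

/-- The `C(Y)`-valued inner product `⟨T, S⟩ = ∑_γ T(γ)^* S(γ)` on `C_c(Γ, C(Y))`. -/
def innerC {Γ : Type u} {Y : Type w} [TopologicalSpace Y] (T S : Γ →₀ C(Y, ℂ)) : C(Y, ℂ) :=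
  ∑ γ ∈ T.support, star (T γ) * S γ

/-- The norm `‖T‖ = ‖⟨T, T⟩‖^{1/2}` on `C_c(Γ, C(Y))`, for a compact space `Y`. -/
def normC {Γ : Type u} {Y : Type w} [TopologicalSpace Y] [CompactSpace Y]
    (T : Γ →₀ C(Y, ℂ)) : ℝ :=
  Real.sqrt ‖innerC T T‖

end

/-- A discrete group `Γ` is boundary amenable (or exact) if it acts by homeomorphisms on a nonempty
compact Hausdorff space `Y` for which there is a sequence in `C_c(Γ, C(Y))` of positive functions
of unit square sum that is asymptotically invariant under translation by each element of `Γ`. -/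
def BoundaryAmenable (Γ : Type u) [Group Γ] : Prop :=
  ∃ (Y : Type u) (_ : TopologicalSpace Y) (_ : CompactSpace Y) (_ : T2Space Y) (_ : Nonempty Y)
    (_ : MulAction Γ Y) (_ : ContinuousConstSMul Γ Y) (S : ℕ → Γ →₀ C(Y, ℂ)),
    (∀ i γ, 0 ≤ S i γ) ∧
    (∀ i, ∑ γ ∈ (S i).support, S i γ ^ 2 = 1) ∧
    ∀ γ₁ : Γ, Filter.Tendsto (fun i => normC (S i - deltaConv γ₁ (S i))) Filter.atTop (nhds 0)

end BdryAmen

/-!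
A countable group is boundary amenable if and only if it has property A: there are finitely
supported probability measures `μ x` on `Γ`, for `x : Γ`, with supports in a fixed finite set, such
that `g · μ (g⁻¹ x)` is uniformly `ℓ¹`-close to `μ x` for `g` in a given finite set. In one direction
(`BoundaryAmenable.propertyA`) the functions `S i` are evaluated on an orbit in `Y` and squared; in
the other (`PropertyA.boundaryAmenable`) the square roots of the measures are extended to the
Stone-Čech compactification of `Γ`, realized as the space of ultrafilters on `Γ`. It remains to see
that property A passes from a vertex stabilizer to `Γ`, which is `propertyA_of_isTree`.

In a tree, every vertex `v` has a next vertex `stepToward x v` on the way to a vertex `x`. If `v` and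
`w` are adjacent, then one of them is the next vertex of the other, so that the walks from `v` and
from `w` towards `x` agree up to a shift. The uniform measures on the first `N` vertices of these
walks therefore differ by `O(1 / N)`, uniformly in `x`, and the construction is equivariant. With
`x` in the orbit of `v₀`, this gives almost equivariant measures on the vertices, all supported in
one finite set because the tree is locally finite.

To pass from vertices to group elements, fix `s v : Γ` with `s v • v₀ = v`. The stabilizer of `v₀`
has property A, also with its measures indexed by all of `Γ` (`PropertyA.relative`), and translation
by `s v` gives probability measures `ν x v` on the coset of elements sending `v₀` to `v`. Since
`g * s v = s (g • v) * k` with `k` in the stabilizer, and since only finitely many `k` occur for the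
finitely many `g` and `v` in question, `g · ν (g⁻¹ x) v` is close to `ν x (g • v)`. The measure `μ x`
is the average of `ν x v` over the first `N` vertices `v` on the walk from `v₀` to `x • v₀`.
-/

namespace BdryAmen

open Finset

universe u w

/-! ### Property A -/

/-- The intrinsic form of boundary amenability: there are finitely supported probability measures
`μ x` on `Γ`, indexed by `x : Γ`, with a common finite support `F`, that are equivariant up to `ε`
in `ℓ¹`-norm under the elements of a given finite set `E`. The measures are encoded as functions
`Γ → ℝ`, and the bound on the `ℓ¹`-norm as a bound on all finite partial sums. -/
def PropertyA (Γ : Type u) [Group Γ] : Prop :=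
  ∀ (E : Finset Γ) (ε : ℝ), 0 < ε → ∃ (F : Finset Γ) (μ : Γ → Γ → ℝ),
    (∀ x γ, 0 ≤ μ x γ) ∧ (∀ x, ∀ γ ∉ F, μ x γ = 0) ∧ (∀ x, ∑ γ ∈ F, μ x γ = 1) ∧
    ∀ g ∈ E, ∀ x (s : Finset Γ), ∑ γ ∈ s, |μ x γ - μ (g⁻¹ * x) (g⁻¹ * γ)| ≤ ε

theorem sum_le_one_of_support {α : Type*} {F : Finset α} {f : α → ℝ} (h0 : ∀ a, 0 ≤ f a)
    (hF : ∀ a ∉ F, f a = 0) (h1 : ∑ a ∈ F, f a = 1) (s : Finset α) : ∑ a ∈ s, f a ≤ 1 := by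
  classical
  calc ∑ a ∈ s, f a ≤ ∑ a ∈ s ∪ F, f a :=
        sum_le_sum_of_subset_of_nonneg subset_union_left fun a _ _ => h0 a
    _ = ∑ a ∈ F, f a := (sum_subset subset_union_right fun a _ ha => hF a ha).symm
    _ = 1 := h1

/-- Squaring turns `ℓ²`-close vectors of the unit ball into `ℓ¹`-close
vectors, by Cauchy-Schwarz applied to `|f² - h²| = |f - h| |f + h|`. -/
theorem sum_abs_sq_sub_sq_le {α : Type*} (s : Finset α) (f h : α → ℝ) {c : ℝ} (hc : 0 ≤ c)
    (hf : ∑ a ∈ s, f a ^ 2 ≤ 1) (hh : ∑ a ∈ s, h a ^ 2 ≤ 1)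
    (hfh : ∑ a ∈ s, (f a - h a) ^ 2 ≤ c ^ 2) : ∑ a ∈ s, |f a ^ 2 - h a ^ 2| ≤ 2 * c := by
  have hadd : ∑ a ∈ s, (f a + h a) ^ 2 ≤ 2 ^ 2 := by
    calc ∑ a ∈ s, (f a + h a) ^ 2 ≤ ∑ a ∈ s, (2 * f a ^ 2 + 2 * h a ^ 2) :=
          sum_le_sum fun a _ => by nlinarith [sq_nonneg (f a - h a)]
      _ = 2 * ∑ a ∈ s, f a ^ 2 + 2 * ∑ a ∈ s, h a ^ 2 := by
          rw [sum_add_distrib, mul_sum, mul_sum]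
      _ ≤ 2 ^ 2 := by linarith
  have hcs := sum_mul_sq_le_sq_mul_sq s (fun a => |f a - h a|) (fun a => |f a + h a|)
  simp only [← abs_mul, sq_abs] at hcs
  have heq : ∀ a, |f a ^ 2 - h a ^ 2| = |(f a - h a) * (f a + h a)| := fun a => by
    congr 1; ring
  simp only [heq]
  refine abs_le_of_sq_le_sq' ?_ (by positivity) |>.2
  calc _ ≤ _ := hcs
    _ ≤ c ^ 2 * 2 ^ 2 := by gcongr
    _ = _ := by ring

/-! ### The norm of `C_c(Γ, C(Y))`, pointwise -/

section Norm

variable {Γ : Type u} {Y : Type w} [TopologicalSpace Y]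

theorem innerC_self_apply (T : Γ →₀ C(Y, ℂ)) (y : Y) :
    innerC T T y = ((∑ γ ∈ T.support, ‖T γ y‖ ^ 2 : ℝ) : ℂ) := by
  simp [innerC, ContinuousMap.sum_apply, Complex.conj_mul']

variable [CompactSpace Y]

theorem sum_norm_sq_le_normC_sq (T : Γ →₀ C(Y, ℂ)) (y : Y) (s : Finset Γ) :
    ∑ γ ∈ s, ‖T γ y‖ ^ 2 ≤ normC T ^ 2 := by
  classical
  rw [normC, Real.sq_sqrt (norm_nonneg _)]
  calc ∑ γ ∈ s, ‖T γ y‖ ^ 2 ≤ ∑ γ ∈ s ∪ T.support, ‖T γ y‖ ^ 2 :=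
        sum_le_sum_of_subset_of_nonneg subset_union_left fun _ _ _ => by positivity
    _ = ∑ γ ∈ T.support, ‖T γ y‖ ^ 2 :=
        (sum_subset subset_union_right fun γ _ hγ => by
          simp [Finsupp.notMem_support_iff.mp hγ]).symm
    _ = ‖innerC T T y‖ := by
        rw [innerC_self_apply, Complex.norm_real, Real.norm_of_nonneg (by positivity)]
    _ ≤ ‖innerC T T‖ := (innerC T T).norm_coe_le_norm y

theorem normC_le_of_dense {ι : Type*} {p : ι → Y} (hp : DenseRange p) (T : Γ →₀ C(Y, ℂ)) {c : ℝ}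
    (hc : 0 ≤ c) (h : ∀ i, ∑ γ ∈ T.support, ‖T γ (p i)‖ ^ 2 ≤ c) : normC T ≤ √c := by
  refine Real.sqrt_le_sqrt ((ContinuousMap.norm_le _ hc).2 fun y => ?_)
  refine hp.induction_on (p := fun y => ‖innerC T T y‖ ≤ c) y
    (isClosed_le (innerC T T).continuous.norm continuous_const) fun i => ?_
  rw [innerC_self_apply, Complex.norm_real, Real.norm_of_nonneg (by positivity)]
  exact h i

end Norm

/-! ### From boundary amenability to property A -/

/-- The measure `μ x` is the square of `S i`, evaluated at the point `x • y₀` of an orbit. -/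
theorem BoundaryAmenable.propertyA {Γ : Type u} [Group Γ] (h : BoundaryAmenable Γ) :
    PropertyA Γ := by
  obtain ⟨Y, _, _, _, ⟨y₀⟩, _, _, S, hpos, hsum, hlim⟩ := h
  intro E ε hε
  obtain ⟨i, hi⟩ : ∃ i, ∀ g ∈ E, normC (S i - deltaConv g (S i)) < ε / 2 :=
    ((Filter.eventually_all_finset E).2 fun g _ =>
      (hlim g).eventually_lt_const (half_pos hε)).exists
  -- A function that is nonnegative in the complex order is real-valued.
  have hre : ∀ γ y, S i γ y = ((S i γ y).re : ℂ) := fun γ y =>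
    Complex.eq_re_of_ofReal_le (r := 0) (by simpa using hpos i γ y)
  have hone : ∀ x : Γ, ∑ γ ∈ (S i).support, (S i γ (x • y₀)).re ^ 2 = 1 := fun x => by
    have h1 := congr_arg (fun f : C(Y, ℂ) => (f (x • y₀))) (hsum i)
    simp only [ContinuousMap.sum_apply, ContinuousMap.pow_apply, ContinuousMap.one_apply] at h1
    rw [sum_congr rfl fun γ _ => by rw [hre γ]] at h1
    exact_mod_cast h1
  have hzero : ∀ x : Γ, ∀ γ ∉ (S i).support, (S i γ (x • y₀)).re ^ 2 = 0 := fun x γ hγ => by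
    simp [Finsupp.notMem_support_iff.mp hγ]
  have hle : ∀ (x : Γ) (s : Finset Γ), ∑ γ ∈ s, (S i γ (x • y₀)).re ^ 2 ≤ 1 := fun x s =>
    sum_le_one_of_support (fun _ => sq_nonneg _) (hzero x) (hone x) s
  refine ⟨(S i).support, fun x γ => (S i γ (x • y₀)).re ^ 2, fun _ _ => sq_nonneg _, hzero, hone,
    fun g hg x s => ?_⟩
  have hb := sum_abs_sq_sub_sq_le s (fun γ => (S i γ (x • y₀)).re)
    (fun γ => (S i (g⁻¹ * γ) ((g⁻¹ * x) • y₀)).re) (half_pos hε).le (hle x s)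
    (by
      have := hle (g⁻¹ * x) (s.map (mulLeftEmbedding g⁻¹))
      rwa [sum_map] at this)
    (by
      have h2 := sum_norm_sq_le_normC_sq (S i - deltaConv g (S i)) (x • y₀) s
      refine le_trans (le_of_eq (sum_congr rfl fun γ _ => ?_))
        (h2.trans (pow_le_pow_left₀ (Real.sqrt_nonneg _) (hi g hg).le 2))
      rw [Finsupp.sub_apply, deltaConv_apply, ContinuousMap.sub_apply, act_apply, smul_smul,
        hre γ, hre (g⁻¹ * γ), ← Complex.ofReal_sub, Complex.norm_real, Real.norm_eq_abs, sq_abs,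
        Complex.ofReal_re, Complex.ofReal_re])
  linarith

/-! ### Property A of a subgroup, relative to the ambient group -/

/-- Property A of a subgroup `H`, with the index `x` running over the ambient group: the measures of
`H` are pulled back along an `H`-equivariant map `Γ → H`. -/
theorem PropertyA.relative {Γ : Type u} [Group Γ] {H : Subgroup Γ} (hH : PropertyA H)
    (E : Finset Γ) {ε : ℝ} (hε : 0 < ε) : ∃ (F : Finset Γ) (μ : Γ → Γ → ℝ),
    (∀ x γ, 0 ≤ μ x γ) ∧ (∀ x, ∀ γ ∉ F, μ x γ = 0) ∧ (∀ x, ∑ γ ∈ F, μ x γ = 1) ∧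
    ∀ g ∈ E, g ∈ H → ∀ x (s : Finset Γ), ∑ γ ∈ s, |μ x γ - μ (g⁻¹ * x) (g⁻¹ * γ)| ≤ ε := by
  classical
  obtain ⟨F, μ, h0, hF, h1, hE⟩ := hH (E.subtype (· ∈ H)) ε hε
  -- A choice `rep` of representatives of the cosets `H x` gives the `H`-equivariant map
  -- `π x = x * (rep x)⁻¹`.
  let rep : Γ → Γ := fun x => (Quotient.mk (QuotientGroup.rightRel H) x).out
  have hrep : ∀ x, x * (rep x)⁻¹ ∈ H := fun x => by
    have := Quotient.mk_out (s := QuotientGroup.rightRel H) x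
    exact QuotientGroup.rightRel_apply.1 this
  have hrep' : ∀ g ∈ H, ∀ x, rep (g * x) = rep x := fun g hg x => by
    have : Quotient.mk (QuotientGroup.rightRel H) (g * x) = Quotient.mk _ x :=
      Quotient.sound (QuotientGroup.rightRel_apply.2 (by simpa using hg))
    simp only [rep, this]
  let π : Γ → H := fun x => ⟨x * (rep x)⁻¹, hrep x⟩
  have hπ : ∀ (g : H) x, π (g * x) = g * π x := fun g x => by
    ext; simp [π, hrep' g g.2, mul_assoc]
  refine ⟨F.map (Function.Embedding.subtype _),
    fun x γ => if h : γ ∈ H then μ (π x) ⟨γ, h⟩ else 0, ?_, ?_, ?_, ?_⟩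
  · intro x γ
    dsimp only
    split_ifs
    exacts [h0 _ _, le_rfl]
  · intro x γ hγ
    dsimp only
    split_ifs with h
    · exact hF _ _ fun hm => hγ (mem_map.2 ⟨⟨γ, h⟩, hm, rfl⟩)
    · rfl
  · intro x
    rw [sum_map]
    simpa using h1 (π x)
  · intro g hg hgH x s
    have key := hE ⟨g, hgH⟩ (by simpa using hg) (π x) (s.subtype (· ∈ H))
    rw [← hπ] at key
    refine le_trans (le_of_eq ?_) key
    rw [← sum_filter_add_sum_filter_not s (· ∈ H), sum_eq_zero (s := s.filter (· ∉ H)), add_zero]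
    · rw [← sum_subtype_eq_sum_filter]
      refine sum_congr rfl fun a _ => ?_
      have ha : g⁻¹ * (a : Γ) ∈ H := H.mul_mem (H.inv_mem hgH) a.2
      simp only [a.2, ha, dif_pos]
      rfl
    · intro γ hγ
      have hγ' := (mem_filter.1 hγ).2
      have : g⁻¹ * γ ∉ H := by rwa [H.mul_mem_cancel_left (H.inv_mem hgH)]
      simp [hγ', this]

/-! ### From property A to boundary amenability: the action on ultrafilters -/

/-- The space of ultrafilters on `Γ`, which is the Stone-Čech compactification of the discrete space
`Γ`, with the action extending left translation. -/
instance ultrafilterMulAction (Γ : Type u) [Group Γ] : MulAction Γ (Ultrafilter Γ) where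
  smul g 𝒰 := 𝒰.map (g * ·)
  one_smul 𝒰 := by
    change 𝒰.map (1 * ·) = 𝒰
    simp only [one_mul]
    exact 𝒰.map_id'
  mul_smul g h 𝒰 := by
    change 𝒰.map (g * h * ·) = (𝒰.map (h * ·)).map (g * ·)
    simp only [Ultrafilter.map_map, Function.comp_def, mul_assoc]

theorem smul_pure {Γ : Type u} [Group Γ] (g x : Γ) :
    g • (pure x : Ultrafilter Γ) = pure (g * x) := Ultrafilter.map_pure _ _

instance ultrafilterContinuousConstSMul (Γ : Type u) [Group Γ] :
    ContinuousConstSMul Γ (Ultrafilter Γ) where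
  continuous_const_smul g := by
    refine ultrafilterBasis_is_basis.continuous_iff.2 ?_
    rintro _ ⟨s, rfl⟩
    exact ultrafilter_isOpen_basic ((g * ·) ⁻¹' s)

/-- A bounded function on a discrete space extends continuously to its Stone-Čech
compactification. -/
theorem exists_continuousMap_ultrafilter_extending {α : Type*} (f : α → ℝ)
    (h0 : ∀ a, 0 ≤ f a) (h1 : ∀ a, f a ≤ 1) :
    ∃ φ : C(Ultrafilter α, ℂ), ∀ a, φ (pure a) = f a := by
  let f' : α → Set.Icc (0 : ℝ) 1 := fun a => ⟨f a, h0 a, h1 a⟩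
  refine ⟨⟨fun 𝒰 => (((Ultrafilter.extend f' 𝒰 : Set.Icc (0 : ℝ) 1) : ℝ) : ℂ),
    Complex.continuous_ofReal.comp (continuous_subtype_val.comp (continuous_ultrafilter_extend f'))⟩,
    fun a => ?_⟩
  simp [f']

theorem sq_sqrt_sub_sqrt_le {a b : ℝ} (ha : 0 ≤ a) (hb : 0 ≤ b) : (√a - √b) ^ 2 ≤ |a - b| := by
  calc (√a - √b) ^ 2 = |√a - √b| * |√a - √b| := by rw [← sq, sq_abs]
    _ ≤ |√a - √b| * |√a + √b| := by
        refine mul_le_mul_of_nonneg_left ?_ (abs_nonneg _)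
        rw [abs_of_nonneg (add_nonneg (Real.sqrt_nonneg a) (Real.sqrt_nonneg b)), abs_le]
        constructor <;> linarith [Real.sqrt_nonneg a, Real.sqrt_nonneg b]
    _ = |a - b| := by
        rw [← abs_mul]
        congr 1
        linear_combination Real.sq_sqrt ha - Real.sq_sqrt hb

/-- The functions `S n` extend `x ↦ √(μ x γ)` from `Γ` to the space of ultrafilters on `Γ`; the
required identities and estimates pass from the dense subset `Γ` to the whole space. Countability
gives a single sequence of finite subsets that exhausts `Γ`. -/
theorem PropertyA.boundaryAmenable {Γ : Type u} [Group Γ] [Countable Γ] (h : PropertyA Γ) :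
    BoundaryAmenable Γ := by
  classical
  obtain ⟨e, he⟩ := exists_surjective_nat Γ
  choose F μ h0 hF h1 hE using fun n : ℕ =>
    h ((range n).image e) (1 / (n + 1)) Nat.one_div_pos_of_nat
  have hle : ∀ n x γ, μ n x γ ≤ 1 := fun n x γ => by
    simpa using sum_le_one_of_support (h0 n x) (hF n x) (h1 n x) {γ}
  choose φ hφ using fun n γ => exists_continuousMap_ultrafilter_extending
    (fun x => √(μ n x γ)) (fun x => Real.sqrt_nonneg _) (fun x => Real.sqrt_le_one.2 (hle n x γ))
  have hφ0 : ∀ n, ∀ γ ∉ F n, φ n γ = 0 := fun n γ hγ => by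
    refine DFunLike.coe_injective (denseRange_pure.equalizer (φ n γ).continuous
      (0 : C(Ultrafilter Γ, ℂ)).continuous (funext fun x => ?_))
    simp [hφ, hF n x γ hγ]
  let S : ℕ → Γ →₀ C(Ultrafilter Γ, ℂ) := fun n =>
    Finsupp.onFinset (F n) (φ n) fun γ hγ => by_contra fun hn => hγ (hφ0 n γ hn)
  have hS : ∀ n γ, S n γ = φ n γ := fun _ _ => rfl
  refine ⟨Ultrafilter Γ, inferInstance, inferInstance, inferInstance, ⟨pure 1⟩, inferInstance,
    inferInstance, S, fun n γ 𝒰 => ?_, fun n => ?_, fun g => ?_⟩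
  · refine denseRange_pure.induction_on (p := fun 𝒰 => 0 ≤ φ n γ 𝒰) 𝒰
      (isClosed_le continuous_const (φ n γ).continuous) fun x => ?_
    rw [hφ]
    exact Complex.zero_le_real.2 (Real.sqrt_nonneg _)
  · have hsub : ∑ γ ∈ (S n).support, S n γ ^ 2 = ∑ γ ∈ F n, φ n γ ^ 2 :=
      sum_subset Finsupp.support_onFinset_subset fun γ _ hγ => by
        simp [Finsupp.notMem_support_iff.mp hγ]
    rw [hsub]
    refine DFunLike.coe_injective (denseRange_pure.equalizer (ContinuousMap.continuous _)
      (ContinuousMap.continuous _) (funext fun x => ?_))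
    simp only [Function.comp_apply, ContinuousMap.sum_apply, ContinuousMap.pow_apply, hφ,
      ContinuousMap.one_apply]
    rw [← Complex.ofReal_one, ← h1 n x]
    push_cast
    exact sum_congr rfl fun γ _ => by rw [← Complex.ofReal_pow, Real.sq_sqrt (h0 n x γ)]
  · have hlim : Filter.Tendsto (fun n : ℕ => √(1 / ((n : ℝ) + 1))) Filter.atTop (nhds 0) := by
      simpa using tendsto_one_div_add_atTop_nhds_zero_nat.sqrt
    refine squeeze_zero' (Filter.Eventually.of_forall fun n => Real.sqrt_nonneg _) ?_ hlim
    obtain ⟨m, rfl⟩ := he g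
    filter_upwards [Filter.eventually_gt_atTop m] with n hn
    refine normC_le_of_dense denseRange_pure _ (by positivity) fun x => ?_
    refine le_trans (sum_le_sum fun γ _ => ?_)
      (hE n (e m) (mem_image_of_mem e (mem_range.2 hn)) x _)
    rw [Finsupp.sub_apply, deltaConv_apply, ContinuousMap.sub_apply, act_apply, smul_pure, hS, hS,
      hφ, hφ, ← Complex.ofReal_sub, Complex.norm_real, Real.norm_eq_abs, sq_abs]
    exact sq_sqrt_sub_sqrt_le (h0 _ _ _) (h0 _ _ _)

/-! ### Walking along a tree towards a vertex -/

section Tree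

variable {V : Type*} {G : SimpleGraph V} (hG : G.IsTree)

/-- The next vertex after `v` on the path from `v` to `x` in a tree. It is `x` if `v = x`, since
the second vertex of a walk of length zero is its endpoint. -/
noncomputable def stepToward (x v : V) : V := (hG.existsUnique_path v x).choose.snd

theorem snd_eq_stepToward {x v : V} {p : G.Walk v x} (hp : p.IsPath) :
    p.snd = stepToward hG x v := by
  have h := hG.existsUnique_path v x
  rw [stepToward, h.unique h.choose_spec.1 hp]

theorem stepToward_eq_or_adj (x v : V) : stepToward hG x v = v ∨ G.Adj v (stepToward hG x v) := by
  obtain ⟨p, hp, -⟩ := hG.existsUnique_path v x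
  rw [← snd_eq_stepToward hG hp]
  cases p with
  | nil => exact Or.inl rfl
  | cons h q => exact Or.inr (by simpa using h)

/-- Of the two ends of an edge, one lies on the path from the other to `x`. -/
theorem stepToward_of_adj (x : V) {v w : V} (h : G.Adj v w) :
    stepToward hG x v = w ∨ stepToward hG x w = v := by
  obtain ⟨p, hp, -⟩ := hG.existsUnique_path v x
  by_cases hw : w ∈ p.support
  · rw [← snd_eq_stepToward hG hp]
    exact Or.inl (hG.isAcyclic.eq_snd_of_adj_start hp h hw).symm
  · have hq : (SimpleGraph.Walk.cons h.symm p).IsPath := hp.cons hw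
    rw [← snd_eq_stepToward hG hq]
    exact Or.inr (by simp)

theorem map_stepToward (f : G →g G) (hf : Function.Injective f) (x v : V) :
    f (stepToward hG x v) = stepToward hG (f x) (f v) := by
  obtain ⟨p, hp, -⟩ := hG.existsUnique_path v x
  rw [← snd_eq_stepToward hG hp, ← snd_eq_stepToward hG (hp.map hf)]
  simp [SimpleGraph.Walk.snd, SimpleGraph.Walk.getVert_map]

/-- In a locally finite tree, the first `N` vertices of the walk from `v` towards `x` lie in a
finite set that does not depend on `x`. -/
theorem exists_finset_iterate_stepToward_mem [G.LocallyFinite] (v : V) (N : ℕ) :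
    ∃ B : Finset V, ∀ k < N, ∀ x, (stepToward hG x)^[k] v ∈ B := by
  classical
  induction N with
  | zero => exact ⟨∅, by simp⟩
  | succ N ih =>
    obtain ⟨B, hB⟩ := ih
    refine ⟨insert v (B ∪ B.biUnion fun w => G.neighborFinset w), fun k hk x => ?_⟩
    cases k with
    | zero => simp
    | succ k =>
      have hk' := hB k (by lia) x
      rw [Function.iterate_succ_apply']
      refine mem_insert_of_mem (mem_union.2 ?_)
      obtain h | h := stepToward_eq_or_adj hG x ((stepToward hG x)^[k] v)
      · exact Or.inl (h.symm ▸ hk')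
      · exact Or.inr (mem_biUnion.2 ⟨_, hk', (G.mem_neighborFinset _ _).2 h⟩)

/-- The sums of `ν` along the first `N` vertices of the walks from `v` and from `w` towards `x`
differ by at most `2` for each edge between `v` and `w`: the walks from the ends of an edge agree up
to a shift by one, so that all terms but the first and the last cancel. -/
theorem sum_abs_sum_iterate_sub_le {α : Type*} (ν : V → α → ℝ) (s : Finset α)
    (hν : ∀ v, ∑ a ∈ s, |ν v a| ≤ 1) (x : V) (N : ℕ) {v w : V} (p : G.Walk v w) :
    ∑ a ∈ s, |∑ k ∈ range N, ν ((stepToward hG x)^[k] v) a -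
      ∑ k ∈ range N, ν ((stepToward hG x)^[k] w) a| ≤ 2 * p.length := by
  have shift : ∀ v w, stepToward hG x v = w →
      ∑ a ∈ s, |∑ k ∈ range N, ν ((stepToward hG x)^[k] v) a -
        ∑ k ∈ range N, ν ((stepToward hG x)^[k] w) a| ≤ 2 := by
    rintro v w rfl
    simp only [← Function.iterate_succ_apply, ← sum_sub_distrib,
      fun a => sum_range_sub' (fun k => ν ((stepToward hG x)^[k] v) a) N]
    calc _ ≤ ∑ a ∈ s, (|ν v a| + |ν ((stepToward hG x)^[N] v) a|) :=
          sum_le_sum fun a _ => abs_sub _ _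
      _ ≤ 2 := by rw [sum_add_distrib]; linarith [hν v, hν ((stepToward hG x)^[N] v)]
  induction p with
  | nil => simp
  | @cons u v w h p ih =>
    have h1 : ∑ a ∈ s, |∑ k ∈ range N, ν ((stepToward hG x)^[k] u) a -
        ∑ k ∈ range N, ν ((stepToward hG x)^[k] v) a| ≤ 2 := by
      obtain h | h := stepToward_of_adj hG x h
      · exact shift _ _ h
      · simp only [abs_sub_comm (∑ k ∈ range N, ν ((stepToward hG x)^[k] u) _)]
        exact shift _ _ h
    have h2 := sum_le_sum fun a (_ : a ∈ s) =>
      abs_sub_le (∑ k ∈ range N, ν ((stepToward hG x)^[k] u) a)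
        (∑ k ∈ range N, ν ((stepToward hG x)^[k] v) a)
        (∑ k ∈ range N, ν ((stepToward hG x)^[k] w) a)
    rw [sum_add_distrib] at h2
    rw [SimpleGraph.Walk.length_cons]
    push_cast
    linarith

end Tree

/-! ### Property A of a group acting on a tree -/

theorem propertyA_of_isTree {Γ : Type u} [Group Γ] {V : Type w} {G : SimpleGraph V}
    [G.LocallyFinite] (hG : G.IsTree) [MulAction Γ V] [MulAction.IsPretransitive Γ V]
    (hact : ∀ (γ : Γ) (v w : V), G.Adj v w → G.Adj (γ • v) (γ • w)) (v₀ : V)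
    (hstab : PropertyA (MulAction.stabilizer Γ v₀)) : PropertyA Γ := by
  classical
  intro E ε hε
  choose s hs using fun v : V => MulAction.exists_smul_eq Γ v₀ v
  have path := fun g : Γ => hG.connected.exists_walk_length_eq_dist v₀ (g • v₀)
  let D : ℕ := E.sup fun g => G.dist v₀ (g • v₀)
  -- `N` is chosen so that `2 D / N`, the cost of replacing the starting vertex `v₀` of a walk by
  -- `g • v₀`, is below `ε / 2`.
  obtain ⟨N, hN⟩ := exists_nat_gt (4 * D / ε)
  have hN0 : (0 : ℝ) < N := lt_of_le_of_lt (by positivity) hN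
  obtain ⟨B, hB⟩ := exists_finset_iterate_stepToward_mem hG v₀ N
  obtain ⟨F, T, hT0, hTF, hT1, hTE⟩ := hstab.relative
    (image₂ (fun g v => (s (g • v))⁻¹ * g * s v) E B) (half_pos hε)
  -- `ν x v` is the measure of the stabilizer transported by `s v` to the coset of the elements that
  -- send `v₀` to `v`; it has mass one and is almost equivariant in `v` and `x` together, because
  -- `s (g • v)` and `g * s v` differ by an element of the stabilizer.
  let ν : Γ → V → Γ → ℝ := fun x v γ => T ((s v)⁻¹ * x) ((s v)⁻¹ * γ)
  have hν0 : ∀ x v γ, 0 ≤ ν x v γ := fun x v γ => hT0 _ _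
  have hνle : ∀ x v (t : Finset Γ), ∑ γ ∈ t, |ν x v γ| ≤ 1 := fun x v t => by
    simp only [abs_of_nonneg (hν0 x v _)]
    have := sum_le_one_of_support (hT0 _) (hTF _) (hT1 ((s v)⁻¹ * x))
      (t.map (mulLeftEmbedding (s v)⁻¹))
    rwa [sum_map] at this
  have hνg : ∀ g ∈ E, ∀ v ∈ B, ∀ x (t : Finset Γ),
      ∑ γ ∈ t, |ν x (g • v) γ - ν (g⁻¹ * x) v (g⁻¹ * γ)| ≤ ε / 2 := fun g hg v hv x t => by
    have hmem : (s (g • v))⁻¹ * g * s v ∈ MulAction.stabilizer Γ v₀ := by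
      rw [MulAction.mem_stabilizer_iff, mul_smul, mul_smul, hs, inv_smul_eq_iff, hs]
    have := hTE _ (mem_image₂_of_mem hg hv) hmem ((s (g • v))⁻¹ * x)
      (t.map (mulLeftEmbedding (s (g • v))⁻¹))
    rw [sum_map] at this
    simpa [ν, mul_assoc] using this
  -- `c x k v` is the vertex reached from `v` after `k` steps towards `x • v₀`.
  let c : Γ → ℕ → V → V := fun x k => (stepToward hG (x • v₀))^[k]
  have hc : ∀ g x k v, g • c (g⁻¹ * x) k v = c x k (g • v) := fun g x k v => by
    refine Function.Semiconj.iterate_right (f := (g • · : V → V)) (fun v => ?_) k v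
    have := map_stepToward hG ⟨(g • · : V → V), fun h => hact g _ _ h⟩ (MulAction.injective g)
      ((g⁻¹ * x) • v₀) v
    simpa [smul_smul] using this
  let F' : Finset Γ := image₂ (fun v γ => s v * γ) B F
  have hνF : ∀ x, ∀ v ∈ B, ∀ γ ∉ F', ν x v γ = 0 := fun x v hv γ hγ => hTF _ _ fun hm =>
    hγ (mem_image₂.2 ⟨v, hv, _, hm, by simp⟩)
  have hν1 : ∀ x, ∀ v ∈ B, ∑ γ ∈ F', ν x v γ = 1 := fun x v hv => by
    rw [← hT1 ((s v)⁻¹ * x)]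
    have hsub : F.map (mulLeftEmbedding (s v)) ⊆ F' := fun γ hγ => by
      obtain ⟨a, ha, rfl⟩ := mem_map.1 hγ
      exact mem_image₂_of_mem hv ha
    rw [← sum_subset hsub, sum_map]
    · simp [ν]
    · intro γ _ hγ
      refine hTF _ _ fun hm => hγ (mem_map.2 ⟨_, hm, by simp⟩)
  refine ⟨F', fun x γ => (∑ k ∈ range N, ν x (c x k v₀) γ) / N, ?_, ?_, ?_, ?_⟩
  · exact fun x γ => div_nonneg (sum_nonneg fun k _ => hν0 _ _ _) hN0.le
  · intro x γ hγ
    dsimp only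
    rw [sum_eq_zero fun k hk => hνF x _ (hB k (mem_range.1 hk) _) γ hγ, zero_div]
  · intro x
    rw [← sum_div, sum_comm, sum_congr rfl fun k hk => hν1 x _ (hB k (mem_range.1 hk) _)]
    simp [hN0.ne']
  · intro g hg x t
    obtain ⟨p, hp⟩ := path g
    have h1 := sum_abs_sum_iterate_sub_le hG (ν x) t (fun v => hνle x v t) (x • v₀) N p
    have hD : p.length ≤ D := hp ▸ le_sup (f := fun g => G.dist v₀ (g • v₀)) hg
    have hDε : 2 * (D : ℝ) ≤ N * (ε / 2) := by
      rw [div_lt_iff₀ hε] at hN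
      linarith
    have h2 : ∑ γ ∈ t, |∑ k ∈ range N, ν x (c x k (g • v₀)) γ -
        ∑ k ∈ range N, ν (g⁻¹ * x) (c (g⁻¹ * x) k v₀) (g⁻¹ * γ)| ≤ N * (ε / 2) := by
      calc _ ≤ ∑ γ ∈ t, ∑ k ∈ range N, |ν x (c x k (g • v₀)) γ -
            ν (g⁻¹ * x) (c (g⁻¹ * x) k v₀) (g⁻¹ * γ)| := by
            simp only [← sum_sub_distrib]
            exact sum_le_sum fun γ _ => abs_sum_le_sum_abs _ _
        _ = ∑ k ∈ range N, ∑ γ ∈ t, |ν x (c x k (g • v₀)) γ -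
            ν (g⁻¹ * x) (c (g⁻¹ * x) k v₀) (g⁻¹ * γ)| := sum_comm
        _ ≤ ∑ _k ∈ range N, ε / 2 := sum_le_sum fun k hk => by
            simp only [← hc]
            exact hνg g hg _ (hB k (mem_range.1 hk) _) x t
        _ = N * (ε / 2) := by simp
    have h3 := sum_le_sum fun γ (_ : γ ∈ t) => abs_sub_le (∑ k ∈ range N, ν x (c x k v₀) γ)
      (∑ k ∈ range N, ν x (c x k (g • v₀)) γ)
      (∑ k ∈ range N, ν (g⁻¹ * x) (c (g⁻¹ * x) k v₀) (g⁻¹ * γ))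
    rw [sum_add_distrib] at h3
    simp only [← sub_div, abs_div, Nat.abs_cast]
    rw [← sum_div, div_le_iff₀ hN0]
    have hpD : (p.length : ℝ) ≤ D := by exact_mod_cast hD
    linarith

end BdryAmen

theorem theorem4p2 {Γ : Type*} [Group Γ] [Countable Γ] {V : Type*} (𝒯 : SimpleGraph V)
    [𝒯.LocallyFinite] (h𝒯 : 𝒯.IsTree) [MulAction Γ V]
    (hact : ∀ (γ : Γ) (v w : V), 𝒯.Adj v w → 𝒯.Adj (γ • v) (γ • w))
    (htrans : MulAction.IsPretransitive Γ V)
    (hstab : ∀ v : V, BdryAmen.BoundaryAmenable (MulAction.stabilizer Γ v)) :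
    BdryAmen.BoundaryAmenable Γ := by
  obtain ⟨v₀⟩ := h𝒯.connected.nonempty
  exact (BdryAmen.propertyA_of_isTree h𝒯 hact v₀ (hstab v₀).propertyA).boundaryAmenable
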